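/- **Theorem (Value function subdifferential).** Let $A\in\mathbb R^{m\times n}$, $b\in\mathbb R^m$, $\tau\in\mathbb R$, and let $\rho:\mathbb R^m\to(-\infty,\infty]$ and $\varphi:\mathbb R^n\to(-\infty,\infty]$ be closed, proper and convex. Write $\mathrm{lev}_\tau\varphi=\{x:\varphi(x)\le\tau\}$, $\delta_S$ for the indicator of a set $S$ ($0$ on $S$, $+\infty$ off $S$), $\sigma_S(y)=\sup_{x\in S}\langle y,x\rangle$, $\mathrm{barr}\,S=\{y:\sup_{x\in S}\langle y,x\rangle<\infty\}$, $N(x\,|\,S)=\{s:\langle s,z-x\rangle\le0\ \forall z\in S\}$ for $x\in S$ (and $N(x\,|\,S)=\emptyset$ for $x\notin S$), $\mathrm{ri}$ for the relative interior, and $\partial$ for the convex subdifferential. For a proper convex $h$ let $h^*$ be its Legendre–Fenchel conjugate, $h^\infty(z)=\sup_{x\in\mathrm{dom}\,h}[h(x+z)-h(x)]$, $\mathrm{hzn}\,h=\{y:h^\infty(y)\le0\}$, and let $h^\pi(z,\lambda)$ be $\lambda h(\lambda^{-1}z)$ if $\lambda>0$, $h^\infty(z)$ if $\lambda=0$ and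 $+\infty$ if $\lambda<0$. Consider the value function $$v(b,\tau)=\inf_x f(x,b,\tau),\qquad f(x,b,\tau)=\rho(b-Ax)+\delta_{\mathrm{epi}\,\varphi}(x,\tau),\tag{$\mathcal P$}$$ the reduced dual problem $$\sup_u\ \big[\langle b,u\rangle-\rho^*(u)-\sigma_{\mathrm{lev}_\tau\varphi}(A^Tu)\big],\tag{$\mathcal D_r$}$$ and put $p_\tau(s,\mu)=\tau\mu+(\varphi^*)^\pi(s,\mu)$. A solution of $(\mathcal P)$ is a minimizer $x$ of $f(\cdot,b,\tau)$ with $f(x,b,\tau)<\infty$, and a solution of $(\mathcal D_r)$ is a maximizer at which the objective is not $-\infty$. Consider the conditions - (PR) $b\in\mathrm{ri}\,\mathrm{dom}\,\rho+A\,\mathrm{ri}\,\mathrm{lev}_\tau\varphi$; - (DR) $\mathrm{ri}\,\mathrm{dom}\,\rho^*\cap A^{-T}\,\mathrm{ri}\,\mathrm{barr}\,\mathrm{lev}_\tau\varphi\neq\emptyset$; - (PC) $\mathrm{hzn}\,\varphi\cap[-A^{-1}\mathrm{hzn}\,\rho]=\{0\}$; - (DC) $b\in\mathrm{int}(\mathrm{dom}\,\rho+A\,\mathrm{lev}_\tau\varphi)$;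 - (OC) for a pair $(\bar x,\bar u)$: $\bar x\in\mathrm{lev}_\tau\varphi$, $\bar u\in\partial\rho(b-A\bar x)$ and $A^T\bar u\in N(\bar x\,|\,\mathrm{lev}_\tau\varphi)$. 1. If $(\bar x,\bar u)$ satisfies (OC), then $\bar x$ solves $(\mathcal P)$ and $\bar u$ solves $(\mathcal D_r)$. 2. If $\bar x$ solves $(\mathcal P)$ and (PR) holds, there exists $\bar u$ such that $(\bar x,\bar u)$ satisfies (OC). 3. If $\bar u$ solves $(\mathcal D_r)$, (DR) holds and $\mathrm{lev}_\tau\varphi\ne\emptyset$, there exists $\bar x$ such that $(\bar x,\bar u)$ satisfies (OC). 4. If (PR) and (DR) hold, then $(\bar x,\bar u)$ satisfies (OC) if and only if $\bar x$ solves $(\mathcal P)$ and $\bar u$ solves $(\mathcal D_r)$. 5. Let $\tau>\inf\varphi$. If either (PC) and (PR) hold, or (DC) and (DR) hold, then $\partial v(b,\tau)\neq\emptyset$, $\operatorname{arg\,min}_{\mu\ge0}p_\tau(A^T\bar u,\mu)\ne\emptyset$ for every $(\bar x,\bar u)$ satisfying (OC), and $$\partial v(b,\tau)=\Big\{\tbinom{\bar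 u}{-\bar\mu}:\ (\bar x,\bar u)\text{ satisfies (OC) for some }\bar x,\ \bar\mu\in\operatorname{arg\,min}_{\mu\ge0}p_\tau(A^T\bar u,\mu)\Big\}$$ $$=\Big\{\tbinom{\bar u}{-\bar\mu}:\ \exists\,\bar x\in\mathrm{lev}_\tau\varphi\text{ with }0\in-A^T\bar u+\bar\mu^+\partial\varphi(\bar x),\ \bar u\in\partial\rho(b-A\bar x),\ \bar\mu\ge0,\ \bar\mu(\varphi(\bar x)-\tau)=0\Big\},$$ where, for $x\in\mathrm{dom}\,\varphi$, $\mu^+\partial\varphi(x)=\{\mu z:z\in\partial\varphi(x)\}$ if $\mu>0$ (so it is empty if $\partial\varphi(x)=\emptyset$) and $0^+\partial\varphi(x)=N(x\,|\,\mathrm{dom}\,\varphi)$. -/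

import Mathlib

open scoped Pointwise

noncomputable section

namespace ValueFn

section General

variable {E : Type*} [NormedAddCommGroup E] [InnerProductSpace ℝ E]

/-- The effective domain of an extended-real-valued function. -/
def dom (h : E → EReal) : Set E := {x | h x < ⊤}

/-- The epigraph, as a subset of `E × ℝ`. -/
def epi (h : E → EReal) : Set (E × ℝ) := {p | h p.1 ≤ (p.2 : EReal)}

/-- The lower level set `{x | h x ≤ τ}`. -/
def lev (h : E → EReal) (τ : ℝ) : Set E := {x | h x ≤ (τ : EReal)}

/-- Closed, proper and convex functions with values in `(-∞, +∞]`. -/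
structure ClosedProperConvex (h : E → EReal) : Prop where
  ne_bot : ∀ x, h x ≠ ⊥
  dom_nonempty : (dom h).Nonempty
  convex_epi : Convex ℝ (epi h)
  closed_epi : IsClosed (epi h)

open Classical in
/-- The indicator of a set: `0` on the set and `+∞` off it. -/
def indic {X : Type*} (S : Set X) (x : X) : EReal := if x ∈ S then 0 else ⊤

/-- The Legendre-Fenchel conjugate. -/
def conj (h : E → EReal) (y : E) : EReal := ⨆ x : E, (((inner ℝ y x : ℝ) : EReal) - h x)

/-- The horizon function `z ↦ sup_{x ∈ dom h} [h (x + z) - h x]`. -/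
def horizon (h : E → EReal) (z : E) : EReal := ⨆ x ∈ dom h, (h (x + z) - h x)

/-- The closure of the perspective function. -/
def persp (h : E → EReal) (z : E) (l : ℝ) : EReal :=
  if 0 < l then (l : EReal) * h (l⁻¹ • z) else if l = 0 then horizon h z else ⊤

/-- The horizon cone of a function. -/
def hzn (h : E → EReal) : Set E := {y | horizon h y ≤ 0}

/-- The support function of a set. -/
def support (C : Set E) (y : E) : EReal := ⨆ x ∈ C, ((inner ℝ y x : ℝ) : EReal)

/-- The barrier cone of a set. -/
def barr (C : Set E) : Set E := {y | ∃ β : ℝ, ∀ x ∈ C, inner ℝ x y ≤ β}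

/-- The normal cone to `C` at `x` (empty if `x ∉ C`). -/
def normalCone (C : Set E) (x : E) : Set E := {s | x ∈ C ∧ ∀ z ∈ C, inner ℝ s (z - x) ≤ 0}

/-- The convex subdifferential (empty at points where `h` is not finite). -/
def subdiff (h : E → EReal) (x : E) : Set E :=
  {s | h x ≠ ⊥ ∧ h x ≠ ⊤ ∧ ∀ z, h x + ((inner ℝ s (z - x) : ℝ) : EReal) ≤ h z}

/-- `μ⁺ ∂h(x)`, that is, the subdifferential at `x` of the function `μ h`, where `0 h` is
understood as the indicator of `dom h`: it is `μ ∂h(x)` for `μ > 0`, and the normal cone to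
`dom h` at `x` for `μ = 0`. -/
def extSubdiff (μ : ℝ) (h : E → EReal) (x : E) : Set E :=
  {s | (0 < μ ∧ ∃ z ∈ subdiff h x, s = μ • z) ∨ (μ = 0 ∧ s ∈ normalCone (dom h) x)}

end General

/-- Minimizers of `g` over `S` (none if `g` is identically `+∞` on `S`). -/
def argmin {X : Type*} (S : Set X) (g : X → EReal) : Set X :=
  {x | x ∈ S ∧ g x ≠ ⊤ ∧ ∀ z ∈ S, g x ≤ g z}

/-- Maximizers of `g` (none if `g` is identically `-∞`). -/
def argmax {X : Type*} (g : X → EReal) : Set X := {x | g x ≠ ⊥ ∧ ∀ z, g z ≤ g x}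

section Problem

variable {m n : ℕ}

/-- The map `x ↦ A x` between Euclidean spaces. -/
abbrev lin (A : Matrix (Fin m) (Fin n) ℝ) :
    EuclideanSpace ℝ (Fin n) →ₗ[ℝ] EuclideanSpace ℝ (Fin m) := Matrix.toEuclideanLin A

variable (A : Matrix (Fin m) (Fin n) ℝ) (ρ : EuclideanSpace ℝ (Fin m) → EReal)
  (φ : EuclideanSpace ℝ (Fin n) → EReal)

/-- The objective `f(x, b, τ) = ρ(b - A x) + indicator of epi φ at (x, τ)`. -/
def objective (b : EuclideanSpace ℝ (Fin m)) (τ : ℝ) (x : EuclideanSpace ℝ (Fin n)) : EReal :=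
  ρ (b - lin A x) + indic (epi φ) (x, τ)

/-- The value function `v(b, τ) = inf_x f(x, b, τ)` on `ℝᵐ × ℝ` with its Euclidean structure. -/
def value (p : WithLp 2 (EuclideanSpace ℝ (Fin m) × ℝ)) : EReal :=
  ⨅ x : EuclideanSpace ℝ (Fin n), objective A ρ φ p.fst p.snd x

/-- The solution set of the primal problem `min_x f(x, b, τ)`. -/
def primalSol (b : EuclideanSpace ℝ (Fin m)) (τ : ℝ) : Set (EuclideanSpace ℝ (Fin n)) :=
  argmin Set.univ (objective A ρ φ b τ)

/-- The solution set of the reduced dual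
`max_u [⟨b, u⟩ - ρ*(u) - support function of lev φ τ at Aᵀ u]`. -/
def reducedDualSol (b : EuclideanSpace ℝ (Fin m)) (τ : ℝ) : Set (EuclideanSpace ℝ (Fin m)) :=
  argmax fun u => ((inner ℝ b u : ℝ) : EReal) - conj ρ u - support (lev φ τ) (lin A.transpose u)

/-- `p_τ(s, μ) = τ μ + (φ*)^π(s, μ)`. -/
def pfun (τ : ℝ) (s : EuclideanSpace ℝ (Fin n)) (μ : ℝ) : EReal :=
  ((τ * μ : ℝ) : EReal) + persp (conj φ) s μ

/-- The minimizers of `p_τ(s, μ)` over `μ ≥ 0`. -/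
def multipliers (τ : ℝ) (s : EuclideanSpace ℝ (Fin n)) : Set ℝ :=
  argmin (Set.Ici 0) (pfun φ τ s)

/-- `x ∈ lev φ τ`, `u ∈ ∂ρ(b - A x)` and `Aᵀ u ∈ N(x | lev φ τ)`. -/
def OptCond (b : EuclideanSpace ℝ (Fin m)) (τ : ℝ) (x : EuclideanSpace ℝ (Fin n))
    (u : EuclideanSpace ℝ (Fin m)) : Prop :=
  x ∈ lev φ τ ∧ u ∈ subdiff ρ (b - lin A x) ∧ lin A.transpose u ∈ normalCone (lev φ τ) x

/-- `b ∈ ri dom ρ + A ri lev φ τ`. -/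
def PrimalRegular (b : EuclideanSpace ℝ (Fin m)) (τ : ℝ) : Prop :=
  b ∈ intrinsicInterior ℝ (dom ρ) + lin A '' intrinsicInterior ℝ (lev φ τ)

/-- `ri dom ρ* ∩ A⁻ᵀ ri barr lev φ τ ≠ ∅`. -/
def DualRegular (τ : ℝ) : Prop :=
  (intrinsicInterior ℝ (dom (conj ρ)) ∩
    lin A.transpose ⁻¹' intrinsicInterior ℝ (barr (lev φ τ))).Nonempty

/-- `hzn φ ∩ [-A⁻¹ hzn ρ] = {0}`. -/
def PrimalCoercive : Prop := hzn φ ∩ -(lin A ⁻¹' hzn ρ) = {0}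

/-- `b ∈ int (dom ρ + A lev φ τ)`. -/
def DualCoercive (b : EuclideanSpace ℝ (Fin m)) (τ : ℝ) : Prop :=
  b ∈ interior (dom ρ + lin A '' lev φ τ)

end Problem

end ValueFn

end

/-!
All duality is read off from one consequence of the Hahn–Banach theorem, `exists_multiplier`: a
convex perturbation function whose domain contains the origin in its relative interior has an
affine minorant that is exact at the origin. No calculus of relative interiors is needed. What is
used about `b ∈ ri dom ρ + A ri lev φ τ`, about its dual analogue, and about an interior point, is
only that segments ending at the point can be prolonged (`RelCore`), and this is inherited by
linear images and sums.

The optimality conditions for `(x, u)` say that the primal value at `x` equals the dual value at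
`u` (`optCond_iff`), so weak duality makes both points optimal. Perturbing the primal constraint
`w + A x = b` gives dual attainment (`exists_dualMinorant`). Perturbing the dual constraint
`Aᵀ u = s` gives a multiplier `x`, which the Fenchel–Moreau theorem for `ρ` and for the closed
convex set `lev φ τ` identifies as a primal solution (`DualRegular.exists_le`).

For the value function, `p_τ(s, ·)` is the Lagrangian dual function of the problem of maximizing
`⟨s, ·⟩` over `φ ≤ τ` (`pfun_le_iff`), so under Slater's condition its minimum over `μ ≥ 0` is
attained and equals the support function of `lev φ τ` at `s`. Once a primal solution exists, by
coercivity or by dual regularity, the three descriptions of `∂v(b, τ)` all amount to the existence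
of a Karush–Kuhn–Tucker triple (`KKT`): see `kkt_iff_optCond`, `kkt_iff_extSubdiff`,
`KKT.mem_subdiff_value` and `exists_kkt_of_mem_subdiff_value`.
-/

namespace ValueFn

/-! ### Lagrange multipliers -/

section Multiplier

variable {F : Type*} [NormedAddCommGroup F] [InnerProductSpace ℝ F]

/-- The base point of a relative interior can be left backwards along any segment that joins it
to a point of the set. -/
lemma exists_sub_smul_mem_of_mem_intrinsicInterior {C : Set F} {x₀ x : F}
    (h₀ : x₀ ∈ intrinsicInterior ℝ C) (hx : x ∈ C) :
    ∃ δ > (0 : ℝ), ∀ ε : ℝ, 0 ≤ ε → ε ≤ δ → x₀ - ε • (x - x₀) ∈ C := by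
  obtain ⟨y, hy, rfl⟩ := mem_intrinsicInterior.1 h₀
  have hxs : x ∈ affineSpan ℝ C := subset_affineSpan ℝ C hx
  let g : ℝ → affineSpan ℝ C := fun ε =>
    ⟨AffineMap.lineMap (y : F) x (-ε), AffineMap.lineMap_mem _ y.2 hxs⟩
  have hg : Continuous g := by
    refine Continuous.subtype_mk ?_ _
    simp only [AffineMap.lineMap_apply]
    fun_prop
  have hg0 : g 0 = y := by ext; simp [g]
  have hmem : g ⁻¹' ((↑) ⁻¹' C) ∈ nhds (0 : ℝ) := by
    apply hg.continuousAt.preimage_mem_nhds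
    rw [hg0]
    exact mem_interior_iff_mem_nhds.1 hy
  obtain ⟨δ, hδ, hball⟩ := Metric.mem_nhds_iff.1 hmem
  refine ⟨δ / 2, by positivity, fun ε h1 h2 => ?_⟩
  have : ε ∈ Metric.ball (0 : ℝ) δ := by
    rw [Metric.mem_ball, Real.dist_eq, sub_zero, abs_of_nonneg h1]; linarith
  have h3 := hball this
  simp only [Set.mem_preimage, g, AffineMap.lineMap_apply, vsub_eq_sub, vadd_eq_add] at h3
  convert h3 using 1
  module

/-- If a small negative multiple of each point of a convex set stays in the set, then the cone over
the set is a linear subspace. -/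
lemma exists_smul_of_mem_span {D : Set F} (hD : Convex ℝ D) (hne : D.Nonempty)
    (habs : ∀ y ∈ D, ∃ ε > (0 : ℝ), -(ε • y) ∈ D) {y : F} (hy : y ∈ Submodule.span ℝ D) :
    ∃ c > (0 : ℝ), ∃ d ∈ D, y = c • d := by
  have hadd : ∀ c₁ > (0 : ℝ), ∀ d₁ ∈ D, ∀ c₂ > (0 : ℝ), ∀ d₂ ∈ D,
      ∃ c > (0 : ℝ), ∃ d ∈ D, c₁ • d₁ + c₂ • d₂ = c • d := by
    intro c₁ h₁ d₁ hd₁ c₂ h₂ d₂ hd₂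
    have hpos : 0 < c₁ + c₂ := by positivity
    refine ⟨c₁ + c₂, hpos, (c₁ / (c₁ + c₂)) • d₁ + (c₂ / (c₁ + c₂)) • d₂,
      hD hd₁ hd₂ (by positivity) (by positivity) (by field_simp), ?_⟩
    rw [smul_add, smul_smul, smul_smul, mul_div_cancel₀ _ hpos.ne', mul_div_cancel₀ _ hpos.ne']
  have hzero : ∃ c > (0 : ℝ), ∃ d ∈ D, (0 : F) = c • d := by
    obtain ⟨d, hd⟩ := hne
    obtain ⟨ε, hε, hd'⟩ := habs d hd
    obtain ⟨c, hc, e, he, h⟩ := hadd ε hε d hd 1 one_pos _ hd'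
    exact ⟨c, hc, e, he, by rw [← h]; module⟩
  induction hy using Submodule.span_induction with
  | mem x h => exact ⟨1, one_pos, x, h, by simp⟩
  | zero => exact hzero
  | add x y _ _ hx hy =>
    obtain ⟨c₁, h₁, d₁, hd₁, rfl⟩ := hx
    obtain ⟨c₂, h₂, d₂, hd₂, rfl⟩ := hy
    exact hadd c₁ h₁ d₁ hd₁ c₂ h₂ d₂ hd₂
  | smul a x _ hx =>
    obtain ⟨c, hc, d, hd, rfl⟩ := hx
    rcases lt_trichotomy a 0 with ha | rfl | ha
    · obtain ⟨ε, hε, hd'⟩ := habs d hd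
      refine ⟨(-a) * c / ε, div_pos (mul_pos (neg_pos.2 ha) hc) hε, _, hd', ?_⟩
      rw [smul_neg, smul_smul, smul_smul, ← neg_smul]
      congr 1
      field_simp
    · simpa using hzero
    · exact ⟨a * c, by positivity, d, hd, by rw [smul_smul]⟩

/-- Lagrange multipliers: `G` plays the role of the epigraph of a convex perturbation function that
is at least `α` at the origin, and the origin lies in the relative interior of its domain (in the
algebraic form `habs`). Then the perturbation function has an affine minorant with value `α` at the
origin. -/
theorem exists_multiplier [FiniteDimensional ℝ F] {G : Set (F × ℝ)} (hG : Convex ℝ G)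
    (habs : ∀ p ∈ G, ∃ ε > (0 : ℝ), ∃ t, (-(ε • p.1), t) ∈ G) {α : ℝ}
    (hα : ∀ t, ((0 : F), t) ∈ G → α ≤ t) :
    ∃ u : F, ∀ p ∈ G, α ≤ p.2 + inner ℝ u p.1 := by
  rcases G.eq_empty_or_nonempty with rfl | hne
  · exact ⟨0, by simp⟩
  set D : Set F := Prod.fst '' G with hDdef
  have hD : Convex ℝ D := hG.linear_image (LinearMap.fst ℝ F ℝ)
  set V := Submodule.span ℝ D with hV
  have hcone : ∀ y ∈ V, ∃ c > (0 : ℝ), ∃ d ∈ D, y = c • d := fun y hy =>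
    exists_smul_of_mem_span hD (hne.image _) (by
      rintro _ ⟨p, hp, rfl⟩
      obtain ⟨ε, hε, t, ht⟩ := habs p hp
      exact ⟨ε, hε, _, ht, rfl⟩) hy
  have hGV : ∀ p ∈ G, p.1 ∈ V := fun p hp => Submodule.subset_span ⟨p, hp, rfl⟩
  -- The cone over `G - (0, α)`, closed upwards, thickened by the orthogonal complement of `V`.
  let P : PointedCone ℝ (F × ℝ) :=
    { carrier := {z | ∃ c : ℝ, 0 ≤ c ∧ ∃ p ∈ G, ∃ q ∈ Vᗮ, z.1 = c • p.1 + q ∧ c * (p.2 - α) ≤ z.2}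
      zero_mem' := by
        obtain ⟨p, hp⟩ := hne
        exact ⟨0, le_rfl, p, hp, 0, Submodule.zero_mem _, by simp, by simp⟩
      add_mem' := by
        rintro z z' ⟨c, hc, p, hp, q, hq, h1, h2⟩ ⟨c', hc', p', hp', q', hq', h1', h2'⟩
        rcases eq_or_lt_of_le (add_nonneg hc hc') with h0 | hpos
        · obtain rfl : c = 0 := by linarith
          obtain rfl : c' = 0 := by linarith
          refine ⟨0, le_rfl, p, hp, q + q', Submodule.add_mem _ hq hq', ?_, ?_⟩
          · simp [h1, h1']
          · simp only [zero_mul, Prod.snd_add] at *; linarith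
        · refine ⟨c + c', hpos.le, (c / (c + c')) • p + (c' / (c + c')) • p',
            hG hp hp' (by positivity) (by positivity) (by field_simp), q + q',
            Submodule.add_mem _ hq hq', ?_, ?_⟩
          · simp only [Prod.fst_add, Prod.smul_fst, h1, h1', smul_add, smul_smul,
              mul_div_cancel₀ _ hpos.ne']
            abel
          · have : (c + c') * (((c / (c + c')) • p + (c' / (c + c')) • p').2 - α)
                = c * (p.2 - α) + c' * (p'.2 - α) := by
              simp only [Prod.snd_add, Prod.smul_snd, smul_eq_mul]
              field_simp
              ring
            rw [this, Prod.snd_add]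
            exact add_le_add h2 h2'
      smul_mem' := by
        rintro ⟨a, ha⟩ z ⟨c, hc, p, hp, q, hq, h1, h2⟩
        refine ⟨a * c, mul_nonneg ha hc, p, hp, a • q, Submodule.smul_mem _ _ hq, ?_, ?_⟩
        · change a • z.1 = _
          rw [h1, smul_add, smul_smul]
        · change _ ≤ a * z.2
          rw [mul_assoc]
          exact mul_le_mul_of_nonneg_left h2 ha }
  let f : (F × ℝ) →ₗ.[ℝ] ℝ :=
    { domain := LinearMap.ker (LinearMap.fst ℝ F ℝ)
      toFun := (LinearMap.snd ℝ F ℝ).comp (Submodule.subtype _) }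
  have hnonneg : ∀ z : f.domain, (z : F × ℝ) ∈ P → 0 ≤ f z := by
    rintro ⟨⟨y, t⟩, hy⟩ ⟨c, hc, p, hp, q, hq, h1, h2⟩
    change (0 : ℝ) ≤ t
    obtain rfl : y = 0 := by simpa [f] using hy
    have hcp : c • p.1 = 0 := by
      have hm : c • p.1 ∈ Vᗮ := by
        rw [eq_neg_of_add_eq_zero_left h1.symm]
        exact Submodule.neg_mem _ hq
      have := V.inner_right_of_mem_orthogonal (Submodule.smul_mem _ c (hGV p hp)) hm
      simpa using this
    rcases eq_or_lt_of_le hc with rfl | hc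
    · simpa using h2
    · have hp0 : p.1 = 0 := (smul_eq_zero.1 hcp).resolve_left hc.ne'
      have := hα p.2 (by rw [← hp0]; exact hp)
      exact le_trans (mul_nonneg hc.le (by linarith)) h2
  have hdense : ∀ z, ∃ w : f.domain, (w : F × ℝ) + z ∈ P := by
    rintro ⟨y, t⟩
    obtain ⟨y₁, hy₁, y₂, hy₂, rfl⟩ := V.exists_add_mem_mem_orthogonal y
    obtain ⟨c, hc, _, ⟨p, hp, rfl⟩, rfl⟩ := hcone y₁ hy₁
    exact ⟨⟨(0, c * (p.2 - α) - t), by simp [f]⟩, c, hc.le, p, hp, y₂, hy₂, by simp, by simp⟩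
  obtain ⟨g, hgf, hgP⟩ := riesz_extension P f hnonneg hdense
  let ℓ : F →L[ℝ] ℝ := LinearMap.toContinuousLinearMap (g.comp (LinearMap.inl ℝ F ℝ))
  refine ⟨(InnerProductSpace.toDual ℝ F).symm ℓ, fun p hp => ?_⟩
  rw [InnerProductSpace.toDual_symm_apply]
  have h1 : 0 ≤ g (p.1, p.2 - α) :=
    hgP _ ⟨1, zero_le_one, p, hp, 0, Submodule.zero_mem _, by simp, by simp⟩
  have h2 : g (0, p.2 - α) = p.2 - α := hgf ⟨(0, p.2 - α), LinearMap.mem_ker.2 rfl⟩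
  have h3 : ℓ p.1 = g (p.1, 0) := rfl
  have h4 : g (p.1, p.2 - α) = g (p.1, 0) + g (0, p.2 - α) := by
    rw [← map_add]; simp
  linarith

end Multiplier

/-! ### Conjugates, support functions and the Fenchel–Moreau theorem -/

section Conjugate

lemma mem_dom_of_le {E : Type*} {h : E → EReal} {x : E} {r : ℝ} (hx : h x ≤ r) : x ∈ dom h :=
  lt_of_le_of_lt hx (EReal.coe_lt_top r)

variable {E : Type*} [NormedAddCommGroup E] [InnerProductSpace ℝ E]

lemma exists_le_coe {x : EReal} (hx : x < ⊤) : ∃ r : ℝ, x ≤ r := by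
  obtain ⟨r, hr, -⟩ := EReal.lt_iff_exists_real_btwn.1 hx
  exact ⟨r, hr.le⟩

lemma exists_eq_coe {x : EReal} (hb : x ≠ ⊥) (ht : x ≠ ⊤) : ∃ r : ℝ, x = r :=
  ⟨x.toReal, (EReal.coe_toReal ht hb).symm⟩

lemma ClosedProperConvex.exists_eq_coe_of_le {h : E → EReal} (hh : ClosedProperConvex h) {x : E}
    {r : ℝ} (hx : h x ≤ r) : ∃ a : ℝ, h x = a :=
  exists_eq_coe (hh.ne_bot x) (mem_dom_of_le hx).ne

lemma ClosedProperConvex.exists_le {h : E → EReal} (hh : ClosedProperConvex h) :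
    ∃ x, ∃ r : ℝ, h x ≤ r := by
  obtain ⟨x, hx⟩ := hh.dom_nonempty
  exact ⟨x, exists_le_coe hx⟩

lemma ClosedProperConvex.combo_le {h : E → EReal} (hh : ClosedProperConvex h) {x y : E}
    {r t a b : ℝ} (hx : h x ≤ r) (hy : h y ≤ t) (ha : 0 ≤ a) (hb : 0 ≤ b) (hab : a + b = 1) :
    h (a • x + b • y) ≤ ((a * r + b * t : ℝ) : EReal) :=
  hh.convex_epi (x := (x, r)) hx (y := (y, t)) hy ha hb hab

lemma ClosedProperConvex.convex_lev {h : E → EReal} (hh : ClosedProperConvex h) (τ : ℝ) :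
    Convex ℝ (lev h τ) := by
  intro x hx y hy a b ha hb hab
  have := hh.combo_le hx hy ha hb hab
  rwa [← add_mul, hab, one_mul] at this

lemma ClosedProperConvex.isClosed_lev {h : E → EReal} (hh : ClosedProperConvex h) (τ : ℝ) :
    IsClosed (lev h τ) :=
  hh.closed_epi.preimage (f := fun x : E => (x, τ)) (by fun_prop)

lemma conj_le_iff {h : E → EReal} (hb : ∀ x, h x ≠ ⊥) {y : E} {c : ℝ} :
    conj h y ≤ c ↔ ∀ x, ∀ r : ℝ, h x ≤ r → inner ℝ y x - r ≤ c := by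
  rw [conj, iSup_le_iff]
  refine forall_congr' fun x => ?_
  induction hx : h x with
  | bot => exact absurd hx (hb x)
  | top => simp
  | coe a =>
    constructor
    · intro H r hr
      have h1 : inner ℝ y x - a ≤ c := by exact_mod_cast H
      have h2 : a ≤ r := by exact_mod_cast hr
      linarith
    · intro H
      exact_mod_cast H a le_rfl

lemma support_le_iff {C : Set E} {y : E} {c : ℝ} :
    support C y ≤ c ↔ ∀ x ∈ C, inner ℝ y x ≤ c := by
  simp [support]

lemma mem_barr_iff {C : Set E} {y : E} : y ∈ barr C ↔ ∃ c : ℝ, ∀ x ∈ C, inner ℝ y x ≤ c := by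
  simp only [barr, Set.mem_ofPred_eq, real_inner_comm]

lemma ClosedProperConvex.conj_ne_bot {h : E → EReal} (hh : ClosedProperConvex h) (y : E) :
    conj h y ≠ ⊥ := by
  obtain ⟨x, r, hx⟩ := hh.exists_le
  intro H
  have := (conj_le_iff hh.ne_bot (y := y) (c := inner ℝ y x - r - 1)).1 (by simp [H]) x r hx
  linarith

lemma support_ne_bot {C : Set E} (hC : C.Nonempty) (y : E) : support C y ≠ ⊥ := by
  obtain ⟨x, hx⟩ := hC
  intro H
  have := (support_le_iff (C := C) (y := y) (c := inner ℝ y x - 1)).1 (by simp [H]) x hx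
  linarith

variable [FiniteDimensional ℝ E]

/-- A point outside the epigraph is strictly separated from it; `κ` is the slope of the separating
hyperplane, which is vertical when `κ = 0`. -/
lemma ClosedProperConvex.exists_separation {h : E → EReal} (hh : ClosedProperConvex h) {x : E}
    {d : ℝ} (hx : ¬ h x ≤ d) :
    ∃ (v : E) (κ c : ℝ), 0 ≤ κ ∧ c < inner ℝ v x - κ * d ∧
      ∀ z, ∀ r : ℝ, h z ≤ r → inner ℝ v z - κ * r < c := by
  obtain ⟨f, c, hf, hc⟩ := geometric_hahn_banach_closed_point (x := (x, d)) hh.convex_epi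
    hh.closed_epi hx
  let ℓ : E →L[ℝ] ℝ := f.comp (ContinuousLinearMap.inl ℝ E ℝ)
  have hsplit : ∀ z, ∀ r : ℝ,
      f (z, r) = inner ℝ ((InnerProductSpace.toDual ℝ E).symm ℓ) z - (-f (0, 1)) * r := by
    intro z r
    rw [InnerProductSpace.toDual_symm_apply]
    have h1 : ((z, r) : E × ℝ) = (z, 0) + r • ((0 : E), (1 : ℝ)) := by simp
    have h2 : ℓ z = f (z, 0) := rfl
    rw [h1, map_add, map_smul, h2, smul_eq_mul]
    ring
  have hlt : ∀ z, ∀ r : ℝ, h z ≤ r →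
      inner ℝ ((InnerProductSpace.toDual ℝ E).symm ℓ) z - (-f (0, 1)) * r < c := fun z r hz => by
    rw [← hsplit]; exact hf (z, r) hz
  refine ⟨_, -f (0, 1), c, ?_, by rw [← hsplit]; exact hc, hlt⟩
  by_contra! hneg
  obtain ⟨z, r, hz⟩ := hh.exists_le
  set w := inner ℝ ((InnerProductSpace.toDual ℝ E).symm ℓ) z
  set κ := -f (0, 1)
  -- The epigraph contains the whole upward ray, on which a negative slope is impossible.
  have h1 := hlt z r hz
  have h2 := hlt z (r + (c - w + κ * r) / (-κ)) (hz.trans (by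
    have : 0 ≤ (c - w + κ * r) / (-κ) := div_nonneg (by linarith) (by linarith)
    exact_mod_cast (by linarith)))
  have h3 : κ * ((c - w + κ * r) / (-κ)) = -(c - w + κ * r) := by
    rw [div_neg, mul_neg, mul_div_cancel₀ _ hneg.ne]
  rw [mul_add, h3] at h2
  linarith

/-- A closed proper convex function has an affine minorant. -/
lemma ClosedProperConvex.exists_conj_le {h : E → EReal} (hh : ClosedProperConvex h) :
    ∃ u, ∃ a : ℝ, conj h u ≤ a := by
  obtain ⟨x, r, hx⟩ := hh.exists_le
  obtain ⟨r, hr⟩ := hh.exists_eq_coe_of_le hx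
  obtain ⟨v, κ, c, hκ, h1, h2⟩ := hh.exists_separation (x := x) (d := r - 1) (by
    rw [hr]; norm_cast; linarith)
  have h3 := h2 x r hr.le
  have hκ : 0 < κ := by nlinarith
  refine ⟨κ⁻¹ • v, c / κ, (conj_le_iff hh.ne_bot).2 fun z t hz => ?_⟩
  rw [real_inner_smul_left, le_div_iff₀ hκ]
  have := h2 z t hz
  have h4 : (κ⁻¹ * inner ℝ v z - t) * κ = inner ℝ v z - κ * t := by field_simp
  linarith

/-- Fenchel–Moreau: a closed proper convex function is the supremum of its affine minorants. -/
theorem ClosedProperConvex.le_of_forall_conj {h : E → EReal} (hh : ClosedProperConvex h) {x : E}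
    {d : ℝ} (H : ∀ u, ∀ a : ℝ, conj h u ≤ a → inner ℝ u x - a ≤ d) : h x ≤ d := by
  by_contra hx
  obtain ⟨v, κ, c, hκ, h1, h2⟩ := hh.exists_separation hx
  rcases eq_or_lt_of_le hκ with rfl | hκ
  · -- A vertical hyperplane: tilt an affine minorant by a large multiple of its normal.
    obtain ⟨u₀, a₀, h₀⟩ := hh.exists_conj_le
    rw [conj_le_iff hh.ne_bot] at h₀
    have hpos : 0 < inner ℝ v x - c := by linarith
    have key : ∀ k : ℝ, 0 ≤ k → inner ℝ u₀ x + k * inner ℝ v x - (a₀ + k * c) ≤ d := by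
      intro k hk
      have := H (u₀ + k • v) (a₀ + k * c) ((conj_le_iff hh.ne_bot).2 fun z r hz => by
        have h3 := h₀ z r hz
        have h4 := h2 z r hz
        rw [inner_add_left, real_inner_smul_left]
        nlinarith)
      rwa [inner_add_left, real_inner_smul_left] at this
    have h5 := key ((|d - inner ℝ u₀ x + a₀| + 1) / (inner ℝ v x - c)) (by positivity)
    have h6 : (|d - inner ℝ u₀ x + a₀| + 1) / (inner ℝ v x - c) * (inner ℝ v x - c)
      = |d - inner ℝ u₀ x + a₀| + 1 := div_mul_cancel₀ _ hpos.ne'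
    have := le_abs_self (d - inner ℝ u₀ x + a₀)
    nlinarith
  · have h3 := H (κ⁻¹ • v) (c / κ) ((conj_le_iff hh.ne_bot).2 fun z t hz => by
      rw [real_inner_smul_left, le_div_iff₀ hκ]
      have := h2 z t hz
      have h4 : (κ⁻¹ * inner ℝ v z - t) * κ = inner ℝ v z - κ * t := by field_simp
      linarith)
    rw [real_inner_smul_left, sub_le_iff_le_add, inv_mul_le_iff₀ hκ, mul_add,
      mul_div_cancel₀ _ hκ.ne'] at h3
    linarith

/-- A closed convex set is the intersection of the half-spaces containing it; it is enough to test
with a support function up to an additive error, because of positive homogeneity. -/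
lemma mem_of_forall_inner_le {C : Set E} (hC : Convex ℝ C) (hcl : IsClosed C) {x : E} {d : ℝ}
    (H : ∀ s, ∀ c : ℝ, (∀ z ∈ C, inner ℝ s z ≤ c) → inner ℝ s x - c ≤ d) : x ∈ C := by
  by_contra hx
  obtain ⟨f, c, hf, hc⟩ := geometric_hahn_banach_closed_point hC hcl hx
  set v := (InnerProductSpace.toDual ℝ E).symm f
  have hv : ∀ z, f z = inner ℝ v z := fun z => (InnerProductSpace.toDual_symm_apply).symm
  simp only [hv] at hf hc
  have hpos : 0 < inner ℝ v x - c := by linarith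
  set k := (|d| + 1) / (inner ℝ v x - c) with hk
  have hk0 : 0 ≤ k := by positivity
  have h1 := H (k • v) (k * c) fun z hz => by
    rw [real_inner_smul_left]
    exact mul_le_mul_of_nonneg_left (hf z hz).le hk0
  rw [real_inner_smul_left, ← mul_sub, hk, div_mul_cancel₀ _ hpos.ne'] at h1
  have := le_abs_self d
  linarith

/-- The horizon function of the conjugate is the support function of the domain. -/
lemma ClosedProperConvex.horizon_conj_le_iff {h : E → EReal} (hh : ClosedProperConvex h) {s : E}
    {c : ℝ} : horizon (conj h) s ≤ c ↔ ∀ x ∈ dom h, inner ℝ s x ≤ c := by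
  rw [horizon, iSup₂_le_iff]
  constructor
  · intro H x hx
    obtain ⟨r, hr⟩ := exists_le_coe hx
    obtain ⟨u, a, hu⟩ := hh.exists_conj_le
    have hstep : ∀ k : ℕ, conj h (u + (k : ℝ) • s) ≤ ((a + k * c : ℝ) : EReal) := by
      intro k
      induction k with
      | zero => simpa using hu
      | succ k ih =>
        have h1 := H _ (mem_dom_of_le ih)
        rw [EReal.sub_le_iff_le_add (.inl (hh.conj_ne_bot _)) (.inr (EReal.coe_ne_bot _))] at h1
        have h2 : u + ((k + 1 : ℕ) : ℝ) • s = u + (k : ℝ) • s + s := by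
          push_cast; module
        rw [h2]
        refine h1.trans ((add_le_add le_rfl ih).trans (le_of_eq ?_))
        norm_cast
        push_cast
        ring
    by_contra! hlt
    have hpos : 0 < inner ℝ s x - c := by linarith
    obtain ⟨k, hk⟩ := exists_nat_gt ((a + r - inner ℝ u x) / (inner ℝ s x - c))
    rw [div_lt_iff₀ hpos] at hk
    have h3 := (conj_le_iff hh.ne_bot).1 (hstep k) x r hr
    rw [inner_add_left, real_inner_smul_left] at h3
    nlinarith
  · intro H y hy
    obtain ⟨a, ha⟩ := exists_eq_coe (hh.conj_ne_bot y) (ne_of_lt hy)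
    have h1 : conj h (y + s) ≤ ((c + a : ℝ) : EReal) := (conj_le_iff hh.ne_bot).2 fun x r hx => by
      have h2 := (conj_le_iff hh.ne_bot).1 ha.le x r hx
      have h3 := H x (mem_dom_of_le hx)
      rw [inner_add_left]
      linarith
    rw [ha, EReal.sub_le_iff_le_add (by simp) (by simp)]
    exact_mod_cast h1

/-- For `μ ≥ 0`, `p_τ(s, μ)` is the value of the Lagrangian dual function of the problem of
maximizing `⟨s, ·⟩` subject to `φ ≤ τ`. -/
lemma pfun_le_iff {φ : E → EReal} (hφ : ClosedProperConvex φ) {τ μ c : ℝ} {s : E} (hμ : 0 ≤ μ) :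
    ((τ * μ : ℝ) : EReal) + persp (conj φ) s μ ≤ c ↔
      ∀ x, ∀ t : ℝ, φ x ≤ t → inner ℝ s x - μ * (t - τ) ≤ c := by
  rcases eq_or_lt_of_le hμ with rfl | hμ
  · rw [persp, if_neg (lt_irrefl _), if_pos rfl]
    simp only [mul_zero, EReal.coe_zero, zero_add, zero_mul, sub_zero]
    rw [hφ.horizon_conj_le_iff]
    constructor
    · exact fun H x t hx => H x (mem_dom_of_le hx)
    · intro H x hx
      obtain ⟨t, ht⟩ := exists_le_coe hx
      exact H x t ht
  · have h1 : ((τ * μ : ℝ) : EReal) + persp (conj φ) s μ ≤ c ↔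
        conj φ (μ⁻¹ • s) ≤ (((c - τ * μ) / μ : ℝ) : EReal) := by
      rw [persp, if_pos hμ]
      induction hx : conj φ (μ⁻¹ • s) with
      | bot => exact absurd hx (hφ.conj_ne_bot _)
      | top => rw [EReal.coe_mul_top_of_pos hμ, EReal.coe_add_top]; simp
      | coe a =>
        norm_cast
        rw [le_div_iff₀ hμ]
        constructor <;> intro <;> linarith
    rw [h1, conj_le_iff hφ.ne_bot]
    refine forall_congr' fun x => forall_congr' fun t => forall_congr' fun _ => ?_
    have h2 : (inner ℝ (μ⁻¹ • s) x - t) * μ = inner ℝ s x - μ * t := by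
      rw [real_inner_smul_left]; field_simp
    rw [le_div_iff₀ hμ, h2]
    constructor <;> intro <;> linarith

end Conjugate

/-! ### Relative cores -/

section RelCore

variable {E F H : Type*} [NormedAddCommGroup E] [InnerProductSpace ℝ E]
  [NormedAddCommGroup F] [InnerProductSpace ℝ F] [NormedAddCommGroup H] [InnerProductSpace ℝ H]

/-- Every segment from a point of `S` to `b` can be prolonged beyond `b` inside `S`. For a convex
set in finite dimension with `b ∈ S`, this is membership in the relative interior. -/
def RelCore (S : Set F) (b : F) : Prop := ∀ y ∈ S, ∃ ε > (0 : ℝ), b - ε • (y - b) ∈ S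

lemma relCore_of_mem_interior {S : Set F} {b : F} (hb : b ∈ interior S) : RelCore S b := by
  intro y _
  have hcont : Continuous fun ε : ℝ => b - ε • (y - b) := by fun_prop
  have hmem : (fun ε : ℝ => b - ε • (y - b)) ⁻¹' S ∈ nhds (0 : ℝ) :=
    hcont.continuousAt.preimage_mem_nhds (by simpa using mem_interior_iff_mem_nhds.1 hb)
  obtain ⟨δ, hδ, hball⟩ := Metric.mem_nhds_iff.1 hmem
  refine ⟨δ / 2, by positivity, hball ?_⟩
  rw [Metric.mem_ball, Real.dist_eq, sub_zero, abs_of_pos (by positivity)]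
  linarith

lemma relCore_image_add_image {C : Set E} {D : Set H} (f : E →ₗ[ℝ] F) (g : H →ₗ[ℝ] F) {x₀ : E}
    {y₀ : H} (hx : x₀ ∈ intrinsicInterior ℝ C) (hy : y₀ ∈ intrinsicInterior ℝ D) :
    RelCore (f '' C + g '' D) (f x₀ + g y₀) := by
  rintro _ ⟨_, ⟨x, hxC, rfl⟩, _, ⟨y, hyD, rfl⟩, rfl⟩
  obtain ⟨δ₁, h₁, H₁⟩ := exists_sub_smul_mem_of_mem_intrinsicInterior hx hxC
  obtain ⟨δ₂, h₂, H₂⟩ := exists_sub_smul_mem_of_mem_intrinsicInterior hy hyD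
  have hmin : 0 < min δ₁ δ₂ := lt_min h₁ h₂
  refine ⟨min δ₁ δ₂, hmin, f (x₀ - min δ₁ δ₂ • (x - x₀)),
    ⟨_, H₁ _ hmin.le (min_le_left _ _), rfl⟩, g (y₀ - min δ₁ δ₂ • (y - y₀)),
    ⟨_, H₂ _ hmin.le (min_le_right _ _), rfl⟩, ?_⟩
  simp only [map_sub, map_smul]
  module

end RelCore

/-! ### Subgradients and horizon directions in terms of the epigraph -/

section Epigraph

variable {E : Type*} [NormedAddCommGroup E] [InnerProductSpace ℝ E]

lemma mem_subdiff_iff {h : E → EReal} {x s : E} :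
    s ∈ subdiff h x ↔ ∃ α : ℝ, h x = α ∧ ∀ z, ∀ r : ℝ, h z ≤ r → α + inner ℝ s (z - x) ≤ r := by
  constructor
  · rintro ⟨hb, ht, H⟩
    obtain ⟨α, hα⟩ := exists_eq_coe hb ht
    refine ⟨α, hα, fun z r hz => ?_⟩
    have := (H z).trans hz
    rw [hα] at this
    exact_mod_cast this
  · rintro ⟨α, hα, H⟩
    refine ⟨by simp [hα], by simp [hα], fun z => ?_⟩
    rw [hα, ← EReal.le_of_forall_lt_iff_le]
    intro r hr
    exact_mod_cast H z r hr.le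

lemma mem_hzn_of_ray {h : E → EReal} (hh : ClosedProperConvex h) {x₀ d : E} {r : ℝ}
    (H : ∀ c : ℝ, 0 ≤ c → h (x₀ + c • d) ≤ r) : d ∈ hzn h := by
  change horizon h d ≤ 0
  rw [horizon, iSup₂_le_iff]
  intro x hx
  obtain ⟨a, ha⟩ := exists_eq_coe (hh.ne_bot x) (ne_of_lt hx)
  let f : ℝ → E × ℝ := fun ε => ((1 - ε) • x + ε • x₀ + d, (1 - ε) * a + ε * r)
  have hf : Continuous f := by fun_prop
  have htends : Filter.Tendsto f (nhdsWithin 0 (Set.Ioi 0)) (nhds (x + d, a)) := by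
    have := hf.tendsto 0
    simp only [f, sub_zero, one_smul, zero_smul, add_zero, one_mul, zero_mul] at this
    exact this.mono_left nhdsWithin_le_nhds
  have hmem : (x + d, a) ∈ epi h := by
    refine hh.closed_epi.mem_of_tendsto htends ?_
    filter_upwards [Ioo_mem_nhdsGT (zero_lt_one (α := ℝ))] with ε hε
    -- The point `f ε` is a convex combination of `(x, a)` and of a far point of the ray.
    have h1 := hh.combo_le ha.le (H ε⁻¹ (inv_nonneg.2 hε.1.le)) (sub_nonneg.2 hε.2.le) hε.1.le
      (by ring)
    have h2 : (1 - ε) • x + ε • (x₀ + ε⁻¹ • d) = (1 - ε) • x + ε • x₀ + d := by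
      rw [smul_add, smul_smul, mul_inv_cancel₀ hε.1.ne', one_smul, add_assoc]
    rw [h2] at h1
    exact h1
  rw [ha, EReal.sub_nonpos]
  exact hmem

lemma ClosedProperConvex.lowerSemicontinuous {h : E → EReal} (hh : ClosedProperConvex h) :
    LowerSemicontinuous h := by
  rw [lowerSemicontinuous_iff_isClosed_preimage]
  intro y
  induction y with
  | bot =>
    convert isClosed_empty
    ext x
    simp [hh.ne_bot x]
  | top => simp
  | coe τ => exact hh.isClosed_lev τ

end Epigraph

/-! ### Duality -/

section Duality

variable {m n : ℕ} {A : Matrix (Fin m) (Fin n) ℝ} {ρ : EuclideanSpace ℝ (Fin m) → EReal}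
  {φ : EuclideanSpace ℝ (Fin n) → EReal} {b : EuclideanSpace ℝ (Fin m)} {τ : ℝ}

lemma inner_lin (A : Matrix (Fin m) (Fin n) ℝ) (u : EuclideanSpace ℝ (Fin m))
    (x : EuclideanSpace ℝ (Fin n)) :
    inner ℝ u (lin A x) = inner ℝ (lin A.transpose u) x := by
  rw [← Matrix.conjTranspose_eq_transpose_of_trivial, lin, lin,
    Matrix.toEuclideanLin_conjTranspose_eq_adjoint, LinearMap.adjoint_inner_left]

variable (A ρ φ b τ) in
/-- The objective of the reduced dual problem. -/
noncomputable def reducedDual (u : EuclideanSpace ℝ (Fin m)) : EReal :=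
  ((inner ℝ b u : ℝ) : EReal) - conj ρ u - support (lev φ τ) (lin A.transpose u)

variable (A ρ φ b τ) in
/-- The affine function `y ↦ α - ⟨u, b - y⟩` minorizes the perturbed primal values
`y ↦ inf {ρ w | w + A x = y, x ∈ lev φ τ}`. By `le_reducedDual_iff`, this means that the dual value
at `u` is at least `α`. -/
def DualMinorant (α : ℝ) (u : EuclideanSpace ℝ (Fin m)) : Prop :=
  ∀ w, ∀ r : ℝ, ρ w ≤ r → ∀ x ∈ lev φ τ, α ≤ r + inner ℝ u (b - w - lin A x)

lemma dualMinorant_of_le {u : EuclideanSpace ℝ (Fin m)} {a c : ℝ}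
    (hρ : ClosedProperConvex ρ) (ha : conj ρ u ≤ a)
    (hc : ∀ x ∈ lev φ τ, inner ℝ (lin A.transpose u) x ≤ c) :
    DualMinorant A ρ φ b τ (inner ℝ b u - a - c) u := by
  intro w r hw x hx
  have h1 := (conj_le_iff hρ.ne_bot).1 ha w r hw
  have h2 := hc x hx
  rw [inner_sub_right, inner_sub_right, inner_lin, real_inner_comm]
  linarith

lemma le_reducedDual_iff (hρ : ClosedProperConvex ρ) (hne : (lev φ τ).Nonempty) {α : ℝ}
    {u : EuclideanSpace ℝ (Fin m)} :
    (α : EReal) ≤ reducedDual A ρ φ b τ u ↔ DualMinorant A ρ φ b τ α u := by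
  constructor
  · intro H
    rw [reducedDual] at H
    induction ha : conj ρ u with
    | bot => exact absurd ha (hρ.conj_ne_bot u)
    | top => simp [ha] at H
    | coe a =>
      induction hc : support (lev φ τ) (lin A.transpose u) with
      | bot => exact absurd hc (support_ne_bot hne _)
      | top => simp [hc] at H
      | coe c =>
        rw [ha, hc] at H
        have H' : α ≤ inner ℝ b u - a - c := by exact_mod_cast H
        intro w r hw x hx
        exact H'.trans (dualMinorant_of_le hρ ha.le (support_le_iff.1 hc.le) w r hw x hx)
  · intro H
    obtain ⟨x₀, hx₀⟩ := hne
    have h1 : conj ρ u ≤ ((inner ℝ b u - α - inner ℝ (lin A.transpose u) x₀ : ℝ) : EReal) :=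
      (conj_le_iff hρ.ne_bot).2 fun w r hw => by
        have := H w r hw x₀ hx₀
        rw [inner_sub_right, inner_sub_right, inner_lin, real_inner_comm] at this
        linarith
    obtain ⟨a, ha⟩ := exists_eq_coe (hρ.conj_ne_bot u) (ne_of_lt (mem_dom_of_le h1))
    have h2 : support (lev φ τ) (lin A.transpose u) ≤ ((inner ℝ b u - α - a : ℝ) : EReal) := by
      refine support_le_iff.2 fun x hx => ?_
      have h3 : conj ρ u ≤ ((inner ℝ b u - α - inner ℝ (lin A.transpose u) x : ℝ) : EReal) :=
        (conj_le_iff hρ.ne_bot).2 fun w r hw => by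
          have := H w r hw x hx
          rw [inner_sub_right, inner_sub_right, inner_lin, real_inner_comm] at this
          linarith
      rw [ha] at h3
      have : a ≤ inner ℝ b u - α - inner ℝ (lin A.transpose u) x := by exact_mod_cast h3
      linarith
    obtain ⟨c, hc⟩ := exists_eq_coe (support_ne_bot ⟨x₀, hx₀⟩ (lin A.transpose u))
      (ne_of_lt (lt_of_le_of_lt h2 (EReal.coe_lt_top _)))
    rw [hc] at h2
    have h3 : c ≤ inner ℝ b u - α - a := by exact_mod_cast h2
    rw [reducedDual, ha, hc]
    have h4 : α ≤ inner ℝ b u - a - c := by linarith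
    exact_mod_cast h4

lemma objective_le_iff (hρ : ClosedProperConvex ρ) {x : EuclideanSpace ℝ (Fin n)} {r : ℝ} :
    objective A ρ φ b τ x ≤ r ↔ x ∈ lev φ τ ∧ ρ (b - lin A x) ≤ r := by
  by_cases hx : x ∈ lev φ τ
  · have h1 : (x, τ) ∈ epi φ := hx
    simp [objective, indic, h1, hx]
  · have h1 : (x, τ) ∉ epi φ := hx
    simp [objective, indic, h1, hx, EReal.add_top_of_ne_bot (hρ.ne_bot _)]

lemma objective_of_mem_lev {x : EuclideanSpace ℝ (Fin n)} (hx : x ∈ lev φ τ) :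
    objective A ρ φ b τ x = ρ (b - lin A x) := by
  have h1 : (x, τ) ∈ epi φ := hx
  simp [objective, indic, h1]

lemma mem_primalSol_iff (hρ : ClosedProperConvex ρ) {x : EuclideanSpace ℝ (Fin n)} :
    x ∈ primalSol A ρ φ b τ ↔ x ∈ lev φ τ ∧ ∃ α : ℝ, ρ (b - lin A x) = α ∧
      ∀ z ∈ lev φ τ, ∀ r : ℝ, ρ (b - lin A z) ≤ r → α ≤ r := by
  constructor
  · rintro ⟨-, ht, H⟩
    obtain ⟨r, hr⟩ := exists_le_coe (lt_top_iff_ne_top.2 ht)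
    obtain ⟨hx, hr⟩ := (objective_le_iff hρ).1 hr
    obtain ⟨α, hα⟩ := hρ.exists_eq_coe_of_le hr
    refine ⟨hx, α, hα, fun z hz t ht => ?_⟩
    have := (H z trivial).trans ((objective_le_iff hρ).2 ⟨hz, ht⟩)
    rw [objective_of_mem_lev hx, hα] at this
    exact_mod_cast this
  · rintro ⟨hx, α, hα, H⟩
    refine ⟨trivial, by simp [objective_of_mem_lev hx, hα], fun z _ => ?_⟩
    rw [objective_of_mem_lev hx, hα, ← EReal.le_of_forall_lt_iff_le]
    intro r hr
    obtain ⟨hz, hr⟩ := (objective_le_iff hρ).1 hr.le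
    exact_mod_cast H z hz r hr

/-- The optimality conditions say that the primal value at `x` and the dual value at `u` agree. -/
lemma optCond_iff {x : EuclideanSpace ℝ (Fin n)} {u : EuclideanSpace ℝ (Fin m)} :
    OptCond A ρ φ b τ x u ↔
      x ∈ lev φ τ ∧ ∃ α : ℝ, ρ (b - lin A x) = α ∧ DualMinorant A ρ φ b τ α u := by
  rw [OptCond, mem_subdiff_iff]
  constructor
  · rintro ⟨hx, ⟨α, hα, H⟩, -, hN⟩
    refine ⟨hx, α, hα, fun w r hw z hz => ?_⟩
    have h1 := H w r hw
    have h2 := hN z hz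
    rw [← inner_lin, map_sub] at h2
    simp only [inner_sub_right] at *
    linarith
  · rintro ⟨hx, α, hα, H⟩
    refine ⟨hx, ⟨α, hα, fun w r hw => ?_⟩, hx, fun z hz => ?_⟩
    · have h1 := H w r hw x hx
      simp only [inner_sub_right] at *
      linarith
    · have h1 := H _ α hα.le z hz
      rw [← inner_lin, map_sub]
      simp only [inner_sub_right] at *
      linarith

lemma optCond_of_le (hρ : ClosedProperConvex ρ) {x : EuclideanSpace ℝ (Fin n)}
    {u : EuclideanSpace ℝ (Fin m)} {d : ℝ} (hx : x ∈ lev φ τ) (hd : ρ (b - lin A x) ≤ d)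
    (hu : DualMinorant A ρ φ b τ d u) : OptCond A ρ φ b τ x u := by
  obtain ⟨α, hα⟩ := hρ.exists_eq_coe_of_le hd
  refine optCond_iff.2 ⟨hx, α, hα, fun w r hw z hz => le_trans ?_ (hu w r hw z hz)⟩
  rw [hα] at hd
  exact_mod_cast hd

lemma DualMinorant.le {α r : ℝ} {u : EuclideanSpace ℝ (Fin m)} {x : EuclideanSpace ℝ (Fin n)}
    (hu : DualMinorant A ρ φ b τ α u) (hx : x ∈ lev φ τ) (hr : ρ (b - lin A x) ≤ r) : α ≤ r := by
  simpa using hu _ r hr x hx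

lemma OptCond.mem_primalSol (hρ : ClosedProperConvex ρ) {x : EuclideanSpace ℝ (Fin n)}
    {u : EuclideanSpace ℝ (Fin m)} (h : OptCond A ρ φ b τ x u) : x ∈ primalSol A ρ φ b τ := by
  obtain ⟨hx, α, hα, hu⟩ := optCond_iff.1 h
  exact (mem_primalSol_iff hρ).2 ⟨hx, α, hα, fun z hz r hr => hu.le hz hr⟩

lemma OptCond.mem_reducedDualSol (hρ : ClosedProperConvex ρ) {x : EuclideanSpace ℝ (Fin n)}
    {u : EuclideanSpace ℝ (Fin m)} (h : OptCond A ρ φ b τ x u) :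
    u ∈ reducedDualSol A ρ φ b τ := by
  obtain ⟨hx, α, hα, hu⟩ := optCond_iff.1 h
  have h1 := (le_reducedDual_iff hρ ⟨x, hx⟩).2 hu
  refine ⟨((EReal.bot_lt_coe α).trans_le h1).ne', fun v => le_trans ?_ h1⟩
  rw [← EReal.ge_of_forall_gt_iff_ge]
  intro β hβ
  exact_mod_cast ((le_reducedDual_iff hρ ⟨x, hx⟩).1 hβ.le).le hx hα.le

/-- Without a duality gap, every primal-dual pair of solutions satisfies the optimality
conditions. -/
lemma optCond_of_sol (hρ : ClosedProperConvex ρ) {x : EuclideanSpace ℝ (Fin n)}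
    {u u' : EuclideanSpace ℝ (Fin m)} (h : OptCond A ρ φ b τ x u')
    (hu : u ∈ reducedDualSol A ρ φ b τ) : OptCond A ρ φ b τ x u := by
  obtain ⟨hx, α, hα, hu'⟩ := optCond_iff.1 h
  have h1 := ((le_reducedDual_iff hρ ⟨x, hx⟩).2 hu').trans (hu.2 u')
  exact optCond_iff.2 ⟨hx, α, hα, (le_reducedDual_iff hρ ⟨x, hx⟩).1 h1⟩

lemma PrimalRegular.relCore (h : PrimalRegular A ρ φ b τ) :
    RelCore (dom ρ + lin A '' lev φ τ) b := by
  obtain ⟨w, hw, _, ⟨x, hx, rfl⟩, rfl⟩ := h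
  simpa using relCore_image_add_image LinearMap.id (lin A) hw hx

/-- Strong duality with dual attainment. -/
lemma exists_dualMinorant (hρ : ClosedProperConvex ρ) (hφ : ClosedProperConvex φ)
    (hb : RelCore (dom ρ + lin A '' lev φ τ) b) {α : ℝ}
    (hα : ∀ z ∈ lev φ τ, ∀ r : ℝ, ρ (b - lin A z) ≤ r → α ≤ r) :
    ∃ u, DualMinorant A ρ φ b τ α u := by
  let G : Set (EuclideanSpace ℝ (Fin m) × ℝ) :=
    {p | ∃ w, ∃ x ∈ lev φ τ, ρ w ≤ (p.2 : EReal) ∧ p.1 = w + lin A x - b}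
  have hG : Convex ℝ G := by
    rintro p ⟨w, x, hx, hw, h1⟩ p' ⟨w', x', hx', hw', h1'⟩ s t hs ht hst
    refine ⟨s • w + t • w', s • x + t • x', hφ.convex_lev τ hx hx' hs ht hst,
      hρ.combo_le hw hw' hs ht hst, ?_⟩
    simp only [Prod.fst_add, Prod.smul_fst, h1, h1', map_add, map_smul]
    obtain rfl : t = 1 - s := by linarith
    module
  have habs : ∀ p ∈ G, ∃ ε > (0 : ℝ), ∃ t, (-(ε • p.1), t) ∈ G := by
    rintro ⟨y, r⟩ ⟨w, x, hx, hw, rfl⟩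
    obtain ⟨ε, hε, w', hw', _, ⟨x', hx', rfl⟩, h⟩ := hb (w + lin A x)
      ⟨w, mem_dom_of_le hw, _, ⟨x, hx, rfl⟩, rfl⟩
    obtain ⟨t, ht⟩ := exists_le_coe hw'
    refine ⟨ε, hε, t, w', x', hx', ht, ?_⟩
    have h' : w' + lin A x' = b - ε • (w + lin A x - b) := h
    rw [h']
    simp
  have hlow : ∀ t, (0, t) ∈ G → α ≤ t := by
    rintro t ⟨w, x, hx, hw, h⟩
    refine hα x hx t ?_
    have : b - lin A x = w := by
      rw [eq_comm, sub_eq_zero] at h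
      rw [← h]; abel
    rwa [this]
  obtain ⟨u, hu⟩ := exists_multiplier hG habs hlow
  refine ⟨-u, fun w r hw x hx => ?_⟩
  have h1 := hu (w + lin A x - b, r) ⟨w, x, hx, hw, rfl⟩
  have h2 : b - w - lin A x = -(w + lin A x - b) := by abel
  rwa [h2, inner_neg_neg]

lemma exists_optCond_of_primalSol (hρ : ClosedProperConvex ρ) (hφ : ClosedProperConvex φ)
    (hb : RelCore (dom ρ + lin A '' lev φ τ) b) {x : EuclideanSpace ℝ (Fin n)}
    (hx : x ∈ primalSol A ρ φ b τ) : ∃ u, OptCond A ρ φ b τ x u := by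
  obtain ⟨hx, α, hα, H⟩ := (mem_primalSol_iff hρ).1 hx
  obtain ⟨u, hu⟩ := exists_dualMinorant hρ hφ hb H
  exact ⟨u, optCond_iff.2 ⟨hx, α, hα, hu⟩⟩

/-- Strong duality with primal attainment: if no dual value exceeds `d`, some feasible point has
primal value at most `d`. It is a multiplier for the constraint `Aᵀ u = s` in the dual problem,
and is returned to the primal side by the Fenchel–Moreau theorem. -/
lemma DualRegular.exists_le (hρ : ClosedProperConvex ρ) (hφ : ClosedProperConvex φ)
    (h : DualRegular A ρ φ τ) {d : ℝ}
    (hd : ∀ u, ∀ α : ℝ, DualMinorant A ρ φ b τ α u → α ≤ d) :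
    ∃ x ∈ lev φ τ, ρ (b - lin A x) ≤ d := by
  obtain ⟨u₀, hu₀, hs₀⟩ := h
  have hcore := relCore_image_add_image (lin A.transpose) (-LinearMap.id) hu₀ hs₀
  have hzero : lin A.transpose u₀ + (-LinearMap.id : _ →ₗ[ℝ] _) (lin A.transpose u₀) = 0 := by
    simp
  rw [hzero] at hcore
  let G : Set (EuclideanSpace ℝ (Fin n) × ℝ) :=
    {p | ∃ u s, ∃ a c : ℝ, conj ρ u ≤ a ∧ (∀ x ∈ lev φ τ, inner ℝ s x ≤ c) ∧
      p.1 = lin A.transpose u - s ∧ p.2 = a + c - inner ℝ b u}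
  have hG : Convex ℝ G := by
    rintro p ⟨u, s, a, c, ha, hc, h1, h2⟩ p' ⟨u', s', a', c', ha', hc', h1', h2'⟩ k l hk hl hkl
    refine ⟨k • u + l • u', k • s + l • s', k * a + l * a', k * c + l * c', ?_, ?_, ?_, ?_⟩
    · rw [conj_le_iff hρ.ne_bot] at *
      intro w r hw
      have e1 := mul_le_mul_of_nonneg_left (ha w r hw) hk
      have e2 := mul_le_mul_of_nonneg_left (ha' w r hw) hl
      rw [inner_add_left, real_inner_smul_left, real_inner_smul_left]
      have : r = k * r + l * r := by rw [← add_mul, hkl, one_mul]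
      linarith
    · intro x hx
      rw [inner_add_left, real_inner_smul_left, real_inner_smul_left]
      exact add_le_add (mul_le_mul_of_nonneg_left (hc x hx) hk)
        (mul_le_mul_of_nonneg_left (hc' x hx) hl)
    · simp only [Prod.fst_add, Prod.smul_fst, h1, h1', map_add, map_smul]
      module
    · simp only [Prod.snd_add, Prod.smul_snd, h2, h2', smul_eq_mul, inner_add_right,
        real_inner_smul_right]
      ring
  have habs : ∀ p ∈ G, ∃ ε > (0 : ℝ), ∃ t, (-(ε • p.1), t) ∈ G := by
    rintro ⟨y, t⟩ ⟨u, s, a, c, ha, hc, h1, -⟩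
    obtain ⟨ε, hε, _, ⟨u', hu', rfl⟩, _, ⟨s', hs', rfl⟩, h⟩ := hcore (lin A.transpose u - s)
      ⟨_, ⟨u, mem_dom_of_le ha, rfl⟩, _, ⟨s, mem_barr_iff.2 ⟨c, hc⟩, rfl⟩, by
        simp [sub_eq_add_neg]⟩
    obtain ⟨a', ha'⟩ := exists_le_coe hu'
    obtain ⟨c', hc'⟩ := mem_barr_iff.1 hs'
    refine ⟨ε, hε, _, u', s', a', c', ha', hc', ?_, rfl⟩
    simp only at h h1
    rw [h1]
    simpa [sub_eq_add_neg] using h.symm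
  have hlow : ∀ t, (0, t) ∈ G → -d ≤ t := by
    rintro t ⟨u, s, a, c, ha, hc, h1, rfl⟩
    obtain rfl : lin A.transpose u = s := sub_eq_zero.1 h1.symm
    have := hd u _ (dualMinorant_of_le hρ ha hc)
    linarith
  obtain ⟨x, hx⟩ := exists_multiplier hG habs hlow
  have key : ∀ u s, ∀ a c : ℝ, conj ρ u ≤ a → (∀ x ∈ lev φ τ, inner ℝ s x ≤ c) →
      inner ℝ u (b - lin A x) - a + (inner ℝ s x - c) ≤ d := by
    intro u s a c ha hc
    have h1 := hx (lin A.transpose u - s, a + c - inner ℝ b u) ⟨u, s, a, c, ha, hc, rfl, rfl⟩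
    simp only at h1
    rw [inner_sub_right, real_inner_comm _ x, real_inner_comm s x, ← inner_lin,
      real_inner_comm u b] at h1
    rw [inner_sub_right]
    linarith
  refine ⟨x, ?_, hρ.le_of_forall_conj fun u a ha => ?_⟩
  · have h₀ : u₀ ∈ dom (conj ρ) := intrinsicInterior_subset hu₀
    obtain ⟨a₀, ha₀⟩ := exists_le_coe h₀
    refine mem_of_forall_inner_le (hφ.convex_lev τ) (hφ.isClosed_lev τ)
      (d := d - (inner ℝ u₀ (b - lin A x) - a₀)) fun s c hc => ?_
    have := key u₀ s a₀ c ha₀ hc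
    linarith
  · simpa using key u 0 a 0 ha (by simp)

lemma exists_optCond_of_reducedDualSol (hρ : ClosedProperConvex ρ) (hφ : ClosedProperConvex φ)
    (h : DualRegular A ρ φ τ) (hne : (lev φ τ).Nonempty) {u : EuclideanSpace ℝ (Fin m)}
    (hu : u ∈ reducedDualSol A ρ φ b τ) : ∃ x, OptCond A ρ φ b τ x u := by
  have htop : reducedDual A ρ φ b τ u ≠ ⊤ := by
    intro ht
    obtain ⟨x, hx⟩ := hne
    obtain ⟨w, r, hw⟩ := hρ.exists_le
    have := (le_reducedDual_iff (A := A) (b := b) hρ ⟨x, hx⟩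
      (u := u) (α := r + inner ℝ u (b - w - lin A x) + 1)).1 (by simp [ht]) w r hw x hx
    linarith
  obtain ⟨d, hd⟩ := exists_eq_coe (x := reducedDual A ρ φ b τ u) hu.1 htop
  obtain ⟨x, hx, hle⟩ := h.exists_le (b := b) hρ hφ (d := d) fun v α hv => by
    have : (α : EReal) ≤ reducedDual A ρ φ b τ u :=
      ((le_reducedDual_iff hρ hne).2 hv).trans (hu.2 v)
    rw [hd] at this
    exact_mod_cast this
  exact ⟨x, optCond_of_le hρ hx hle ((le_reducedDual_iff hρ hne).1 hd.ge)⟩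

end Duality

/-! ### Existence of primal solutions -/

section Existence

variable {m n : ℕ} {A : Matrix (Fin m) (Fin n) ℝ} {ρ : EuclideanSpace ℝ (Fin m) → EReal}
  {φ : EuclideanSpace ℝ (Fin n) → EReal} {b : EuclideanSpace ℝ (Fin m)} {τ : ℝ}

lemma exists_feasible (hb : b ∈ dom ρ + lin A '' lev φ τ) :
    ∃ x ∈ lev φ τ, ∃ r : ℝ, ρ (b - lin A x) ≤ r := by
  obtain ⟨w, hw, _, ⟨x, hx, rfl⟩, rfl⟩ := hb
  obtain ⟨r, hr⟩ := exists_le_coe hw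
  exact ⟨x, hx, r, by simpa using hr⟩

/-- Coercivity makes the sublevel sets of the primal problem compact: a direction of recession of
such a set would lie in both horizon cones. -/
lemma PrimalCoercive.exists_primalSol (hρ : ClosedProperConvex ρ) (hφ : ClosedProperConvex φ)
    (h : PrimalCoercive A ρ φ) (hb : b ∈ dom ρ + lin A '' lev φ τ) :
    (primalSol A ρ φ b τ).Nonempty := by
  obtain ⟨x₀, hx₀, r, hr⟩ := exists_feasible hb
  let T : EuclideanSpace ℝ (Fin n) → EuclideanSpace ℝ (Fin m) := fun x => b - lin A x
  have hT : Continuous T := continuous_const.sub (lin A).continuous_of_finiteDimensional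
  set K : Set (EuclideanSpace ℝ (Fin n)) := lev φ τ ∩ T ⁻¹' lev ρ r with hK
  have hcl : IsClosed K := (hφ.isClosed_lev τ).inter ((hρ.isClosed_lev r).preimage hT)
  have hconv : Convex ℝ K := by
    refine (hφ.convex_lev τ).inter fun x hx y hy s t hs ht hst => ?_
    have h1 : T (s • x + t • y) = s • T x + t • T y := by
      simp only [T, map_add, map_smul]
      obtain rfl : t = 1 - s := by linarith
      module
    change T (s • x + t • y) ∈ lev ρ r
    rw [h1]
    exact hρ.convex_lev r hx hy hs ht hst
  have hx₀K : x₀ ∈ K := ⟨hx₀, hr⟩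
  have hbdd : Bornology.IsBounded K := by
    by_contra hunb
    obtain ⟨d, hd0, hd⟩ := not_bounded_iff_exists_ne_zero_mem_asymptoticCone.1 hunb
    have hray : ∀ c : ℝ, 0 ≤ c → x₀ + c • d ∈ K := fun c hc => by
      have := hconv.smul_vadd_mem_of_isClosed_of_mem_asymptoticCone hcl hc hd hx₀K
      rwa [vadd_eq_add, add_comm] at this
    have h1 : d ∈ hzn φ := mem_hzn_of_ray hφ fun c hc => (hray c hc).1
    have h2 : lin A (-d) ∈ hzn ρ := mem_hzn_of_ray hρ (x₀ := T x₀) (r := r) fun c hc => by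
      have h3 : T x₀ + c • lin A (-d) = T (x₀ + c • d) := by
        simp only [T, map_add, map_smul, map_neg]
        module
      rw [h3]
      exact (hray c hc).2
    have h3 : d ∈ hzn φ ∩ -(lin A ⁻¹' hzn ρ) := ⟨h1, h2⟩
    rw [h] at h3
    exact hd0 h3
  have hcomp : IsCompact K := Metric.isCompact_of_isClosed_isBounded hcl hbdd
  have hlsc : LowerSemicontinuous fun x => ρ (T x) := hρ.lowerSemicontinuous.comp hT
  obtain ⟨x, hxK, hmin⟩ := (hlsc.lowerSemicontinuousOn K).exists_isMinOn ⟨x₀, hx₀K⟩ hcomp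
  obtain ⟨α, hα⟩ := hρ.exists_eq_coe_of_le hxK.2
  refine ⟨x, (mem_primalSol_iff hρ).2 ⟨hxK.1, α, hα, fun z hz t ht => ?_⟩⟩
  rcases le_total t r with htr | htr
  · have h1 : z ∈ K := ⟨hz, ht.trans (EReal.coe_le_coe_iff.2 htr)⟩
    have h2 : ρ (T x) ≤ ρ (T z) := hmin h1
    have h3 := h2.trans ht
    change ρ (T x) = α at hα
    rw [hα] at h3
    exact_mod_cast h3
  · have h3 : ρ (b - lin A x) ≤ r := hxK.2
    rw [hα] at h3
    exact (EReal.coe_le_coe_iff.1 h3).trans htr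

lemma DualRegular.exists_primalSol (hρ : ClosedProperConvex ρ) (hφ : ClosedProperConvex φ)
    (h : DualRegular A ρ φ τ) (hb : b ∈ dom ρ + lin A '' lev φ τ) :
    (primalSol A ρ φ b τ).Nonempty := by
  obtain ⟨x₀, hx₀, r₀, hr₀⟩ := exists_feasible hb
  set S : Set ℝ := {r | ∃ z ∈ lev φ τ, ρ (b - lin A z) ≤ r} with hS
  have hbdd : BddBelow S := by
    -- The regularity condition provides a finite dual value, which bounds the primal values.
    obtain ⟨u₀, hu₀, hs₀⟩ := h
    have h₀ : u₀ ∈ dom (conj ρ) := intrinsicInterior_subset hu₀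
    have h₁ : lin A.transpose u₀ ∈ barr (lev φ τ) := intrinsicInterior_subset hs₀
    obtain ⟨a, ha⟩ := exists_le_coe h₀
    obtain ⟨c, hc⟩ := mem_barr_iff.1 h₁
    refine ⟨inner ℝ b u₀ - a - c, ?_⟩
    rintro r ⟨z, hz, hr⟩
    exact (dualMinorant_of_le hρ ha hc).le hz hr
  obtain ⟨x, hx, hle⟩ := h.exists_le (b := b) hρ hφ (d := sInf S) fun u α hu =>
    le_csInf ⟨r₀, x₀, hx₀, hr₀⟩ fun r ⟨z, hz, hr⟩ => hu.le hz hr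
  obtain ⟨α, hα⟩ := hρ.exists_eq_coe_of_le hle
  refine ⟨x, (mem_primalSol_iff hρ).2 ⟨hx, α, hα, fun z hz t ht => ?_⟩⟩
  rw [hα] at hle
  exact (EReal.coe_le_coe_iff.1 hle).trans (csInf_le hbdd ⟨z, hz, ht⟩)

end Existence

/-! ### Multipliers and the subdifferential of the value function -/

section Subdifferential

variable {m n : ℕ} {A : Matrix (Fin m) (Fin n) ℝ} {ρ : EuclideanSpace ℝ (Fin m) → EReal}
  {φ : EuclideanSpace ℝ (Fin n) → EReal} {b : EuclideanSpace ℝ (Fin m)} {τ : ℝ}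

/-- Under Slater's condition, `min_{μ ≥ 0} p_τ(s, μ)` is attained with value `σ_{lev φ τ}(s)`. -/
lemma exists_pfun_le (hφ : ClosedProperConvex φ) (hτ : ∃ x, φ x < (τ : EReal))
    {s : EuclideanSpace ℝ (Fin n)} {c : ℝ} (hc : ∀ x ∈ lev φ τ, inner ℝ s x ≤ c) :
    ∃ μ, 0 ≤ μ ∧ pfun φ τ s μ ≤ c := by
  obtain ⟨z, hz⟩ := hτ
  obtain ⟨η, hη, hητ⟩ := EReal.lt_iff_exists_real_btwn.1 hz
  have hητ' : 0 < τ - η := sub_pos.2 (by exact_mod_cast hητ)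
  let G : Set (ℝ × ℝ) := {p | ∃ x, φ x ≤ ((p.1 + τ : ℝ) : EReal) ∧ p.2 = -inner ℝ s x}
  have hG : Convex ℝ G := by
    rintro p ⟨x, hx, h1⟩ p' ⟨x', hx', h1'⟩ k l hk hl hkl
    refine ⟨k • x + l • x', ?_, ?_⟩
    · have h2 : (k • p + l • p').1 + τ = k * (p.1 + τ) + l * (p'.1 + τ) := by
        simp only [Prod.fst_add, Prod.smul_fst, smul_eq_mul]
        obtain rfl : l = 1 - k := by linarith
        ring
      rw [h2]
      exact hφ.combo_le hx hx' hk hl hkl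
    · simp only [Prod.snd_add, Prod.smul_snd, smul_eq_mul, h1, h1', inner_add_right,
        real_inner_smul_right]
      ring
  have habs : ∀ p ∈ G, ∃ ε > (0 : ℝ), ∃ t, (-(ε • p.1), t) ∈ G := by
    rintro ⟨y, t⟩ -
    refine ⟨(τ - η) / (|y| + 1), by positivity, _, z, hη.le.trans ?_, rfl⟩
    have h1 : (τ - η) / (|y| + 1) * y ≤ τ - η := by
      rw [div_mul_eq_mul_div, div_le_iff₀ (by positivity)]
      exact mul_le_mul_of_nonneg_left (by linarith [le_abs_self y]) hητ'.le
    rw [EReal.coe_le_coe_iff, smul_eq_mul]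
    linarith
  have hlow : ∀ t, ((0 : ℝ), t) ∈ G → -c ≤ t := by
    rintro t ⟨x, hx, h1⟩
    simp only [zero_add] at hx h1
    have := hc x hx
    linarith
  obtain ⟨μ, hμ⟩ := exists_multiplier hG habs hlow
  have key : ∀ x, ∀ t : ℝ, φ x ≤ t → inner ℝ s x - μ * (t - τ) ≤ c := by
    intro x t hx
    have h1 := hμ (t - τ, -inner ℝ s x) ⟨x, by simpa using hx, rfl⟩
    simp only [RCLike.inner_apply, conj_trivial] at h1
    linarith
  have hμ0 : 0 ≤ μ := by
    by_contra! hneg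
    set w := c - inner ℝ s z with hw
    have h1 := key z (τ + (|w| + 1) / (-μ)) (hz.le.trans (by
      have : 0 ≤ (|w| + 1) / (-μ) := div_nonneg (by positivity) (by linarith)
      exact_mod_cast (by linarith)))
    have h2 : μ * (τ + (|w| + 1) / (-μ) - τ) = -(|w| + 1) := by
      rw [add_sub_cancel_left, div_neg, mul_neg, mul_div_cancel₀ _ hneg.ne]
    rw [h2] at h1
    have := le_abs_self w
    linarith
  exact ⟨μ, hμ0, (pfun_le_iff hφ hμ0).2 key⟩

variable (A ρ φ b τ) in
/-- `(x, u, μ)` is a Karush–Kuhn–Tucker triple: `u` is a subgradient of `ρ` at `b - A x`, and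
`(Aᵀ u, -μ)` is normal to `epi φ` at `(x, τ)`. -/
def KKT (x : EuclideanSpace ℝ (Fin n)) (u : EuclideanSpace ℝ (Fin m)) (μ : ℝ) : Prop :=
  x ∈ lev φ τ ∧ u ∈ subdiff ρ (b - lin A x) ∧ 0 ≤ μ ∧
    ∀ z, ∀ t : ℝ, φ z ≤ t → inner ℝ (lin A.transpose u) (z - x) ≤ μ * (t - τ)

lemma KKT.optCond {x : EuclideanSpace ℝ (Fin n)} {u : EuclideanSpace ℝ (Fin m)} {μ : ℝ}
    (h : KKT A ρ φ b τ x u μ) : OptCond A ρ φ b τ x u :=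
  ⟨h.1, h.2.1, h.1, fun z hz => by simpa using h.2.2.2 z τ hz⟩

lemma KKT.pfun_le (hφ : ClosedProperConvex φ) {x : EuclideanSpace ℝ (Fin n)}
    {u : EuclideanSpace ℝ (Fin m)} {μ : ℝ} (h : KKT A ρ φ b τ x u μ) :
    pfun φ τ (lin A.transpose u) μ ≤ (inner ℝ (lin A.transpose u) x : ℝ) :=
  (pfun_le_iff hφ h.2.2.1).2 fun z t hz => by
    have := h.2.2.2 z t hz
    rw [inner_sub_right] at this
    linarith

lemma KKT.mem_multipliers (hφ : ClosedProperConvex φ) {x : EuclideanSpace ℝ (Fin n)}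
    {u : EuclideanSpace ℝ (Fin m)} {μ : ℝ} (h : KKT A ρ φ b τ x u μ) :
    μ ∈ multipliers φ τ (lin A.transpose u) := by
  refine ⟨h.2.2.1, (lt_of_le_of_lt (h.pfun_le hφ) (EReal.coe_lt_top _)).ne, fun ν hν => ?_⟩
  rw [← EReal.le_of_forall_lt_iff_le]
  intro c hc
  have := (pfun_le_iff hφ hν).1 hc.le x τ h.1
  refine (h.pfun_le hφ).trans (EReal.coe_le_coe_iff.2 ?_)
  simpa using this

lemma kkt_of_pfun_le (hφ : ClosedProperConvex φ) {x : EuclideanSpace ℝ (Fin n)}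
    {u : EuclideanSpace ℝ (Fin m)} {μ : ℝ} (h : OptCond A ρ φ b τ x u) (hμ : 0 ≤ μ)
    (hle : pfun φ τ (lin A.transpose u) μ ≤ (inner ℝ (lin A.transpose u) x : ℝ)) :
    KKT A ρ φ b τ x u μ := by
  refine ⟨h.1, h.2.1, hμ, fun z t hz => ?_⟩
  have := (pfun_le_iff hφ hμ).1 hle z t hz
  rw [inner_sub_right]
  linarith

lemma OptCond.exists_kkt (hφ : ClosedProperConvex φ) (hτ : ∃ x, φ x < (τ : EReal))
    {x : EuclideanSpace ℝ (Fin n)} {u : EuclideanSpace ℝ (Fin m)} (h : OptCond A ρ φ b τ x u) :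
    ∃ μ, KKT A ρ φ b τ x u μ := by
  obtain ⟨μ, hμ, hle⟩ := exists_pfun_le hφ hτ (s := lin A.transpose u)
    (c := inner ℝ (lin A.transpose u) x) fun z hz => by
      have := h.2.2.2 z hz
      rw [inner_sub_right] at this
      linarith
  exact ⟨μ, kkt_of_pfun_le hφ h hμ hle⟩

lemma kkt_iff_optCond (hφ : ClosedProperConvex φ) (hτ : ∃ x, φ x < (τ : EReal))
    {x : EuclideanSpace ℝ (Fin n)} {u : EuclideanSpace ℝ (Fin m)} {μ : ℝ} :
    KKT A ρ φ b τ x u μ ↔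
      OptCond A ρ φ b τ x u ∧ μ ∈ multipliers φ τ (lin A.transpose u) := by
  refine ⟨fun h => ⟨h.optCond, h.mem_multipliers hφ⟩, fun ⟨h, hμ⟩ => ?_⟩
  obtain ⟨ν, hν⟩ := h.exists_kkt hφ hτ
  exact kkt_of_pfun_le hφ h hμ.1 ((hμ.2.2 ν hν.2.2.1).trans (hν.pfun_le hφ))

lemma kkt_iff_extSubdiff (hφ : ClosedProperConvex φ) {x : EuclideanSpace ℝ (Fin n)}
    {u : EuclideanSpace ℝ (Fin m)} {μ : ℝ} :
    KKT A ρ φ b τ x u μ ↔ x ∈ lev φ τ ∧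
      0 ∈ {-lin A.transpose u} + extSubdiff μ φ x ∧ u ∈ subdiff ρ (b - lin A x) ∧
      0 ≤ μ ∧ (μ : EReal) * (φ x - (τ : EReal)) = 0 := by
  set s := lin A.transpose u with hs
  have hzero : (0 : EuclideanSpace ℝ (Fin n)) ∈ {-s} + extSubdiff μ φ x ↔
      s ∈ extSubdiff μ φ x := by
    simp [Set.singleton_add]
  rw [hzero, KKT]
  refine and_congr_right fun hx => ?_
  obtain ⟨a, ha⟩ := hφ.exists_eq_coe_of_le hx
  have haτ : a ≤ τ := by
    have h1 : φ x ≤ τ := hx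
    rw [ha] at h1
    exact_mod_cast h1
  have hslack : (μ : EReal) * (φ x - (τ : EReal)) = 0 ↔ μ * (a - τ) = 0 := by
    rw [ha]
    norm_cast
  rw [hslack, and_left_comm (b := u ∈ subdiff ρ (b - lin A x))]
  refine and_congr_right fun _ => ?_
  rw [← hs]
  constructor
  · rintro ⟨hμ, H⟩
    have hcs : μ * (a - τ) = 0 := by
      have h1 := H x a ha.le
      rw [sub_self, inner_zero_right] at h1
      exact le_antisymm (mul_nonpos_of_nonneg_of_nonpos hμ (by linarith)) h1
    refine ⟨?_, hμ, hcs⟩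
    rcases eq_or_lt_of_le hμ with rfl | hμ
    · refine .inr ⟨rfl, mem_dom_of_le hx, fun z hz => ?_⟩
      obtain ⟨t, ht⟩ := exists_le_coe hz
      simpa using H z t ht
    · obtain rfl : a = τ := by
        have := (mul_eq_zero.1 hcs).resolve_left hμ.ne'
        linarith
      refine .inl ⟨hμ, μ⁻¹ • s, mem_subdiff_iff.2 ⟨a, ha, fun z t hz => ?_⟩, ?_⟩
      · have h1 := H z t hz
        rw [real_inner_smul_left]
        have h2 := (inv_mul_le_iff₀ hμ).2 h1
        linarith
      · rw [smul_smul, mul_inv_cancel₀ hμ.ne', one_smul]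
  · rintro ⟨hmem, hμ, hcs⟩
    refine ⟨hμ, fun z t hz => ?_⟩
    rcases hmem with ⟨hpos, v, hv, hsv⟩ | ⟨rfl, -, hN⟩
    · obtain rfl : a = τ := by
        have := (mul_eq_zero.1 hcs).resolve_left hpos.ne'
        linarith
      obtain ⟨a', ha', H⟩ := mem_subdiff_iff.1 hv
      obtain rfl : a = a' := by
        rw [ha] at ha'
        exact_mod_cast ha'
      have h1 := H z t hz
      rw [hsv, real_inner_smul_left]
      exact mul_le_mul_of_nonneg_left (by linarith) hμ
    · simpa using hN z (mem_dom_of_le hz)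

/-- Subgradients of the value function are the affine minorants of `(w, r, x, t) ↦ r` on
`epi ρ × epi φ` that depend on `(w + A x, t)` only. -/
lemma mem_subdiff_value_iff (hρ : ClosedProperConvex ρ) {u : EuclideanSpace ℝ (Fin m)} {l : ℝ} :
    WithLp.toLp 2 (u, l) ∈ subdiff (value A ρ φ) (WithLp.toLp 2 (b, τ)) ↔
      ∃ α : ℝ, value A ρ φ (WithLp.toLp 2 (b, τ)) = α ∧
        ∀ x, ∀ t : ℝ, φ x ≤ t → ∀ w, ∀ r : ℝ, ρ w ≤ r →
          α + inner ℝ u (w + lin A x - b) + l * (t - τ) ≤ r := by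
  have hinner : ∀ (y : EuclideanSpace ℝ (Fin m)) (t : ℝ),
      inner ℝ (WithLp.toLp 2 (u, l)) (WithLp.toLp 2 (y, t) - WithLp.toLp 2 (b, τ)) =
        inner ℝ u (y - b) + l * (t - τ) := by
    intro y t
    simp [WithLp.prod_inner_apply, mul_comm]
  rw [mem_subdiff_iff]
  refine exists_congr fun α => and_congr_right fun _ => ?_
  constructor
  · intro H x t hx w r hw
    have h1 : value A ρ φ (WithLp.toLp 2 (w + lin A x, t)) ≤ r :=
      (iInf_le _ x).trans ((objective_le_iff hρ).2 ⟨hx, by simpa using hw⟩)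
    have h2 := H _ r h1
    rw [hinner] at h2
    linarith
  · intro H z r hz
    refine le_of_forall_pos_le_add fun ε hε => ?_
    have h1 : value A ρ φ z < ((r + ε : ℝ) : EReal) :=
      hz.trans_lt (EReal.coe_lt_coe_iff.2 (by linarith))
    obtain ⟨x, hx⟩ := iInf_lt_iff.1 h1
    obtain ⟨hx1, hx2⟩ := (objective_le_iff hρ).1 hx.le
    have h2 := H x z.snd hx1 _ _ hx2
    have h3 := hinner z.fst z.snd
    rw [sub_add_cancel] at h2
    have h4 : WithLp.toLp 2 (z.fst, z.snd) = z := rfl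
    rw [h4] at h3
    rw [h3]
    linarith

lemma value_eq_of_mem_primalSol {x : EuclideanSpace ℝ (Fin n)} (hx : x ∈ primalSol A ρ φ b τ) :
    value A ρ φ (WithLp.toLp 2 (b, τ)) = objective A ρ φ b τ x :=
  le_antisymm (iInf_le _ x) (le_iInf fun z => hx.2.2 z trivial)

lemma KKT.mem_subdiff_value (hρ : ClosedProperConvex ρ) {x : EuclideanSpace ℝ (Fin n)}
    {u : EuclideanSpace ℝ (Fin m)} {μ : ℝ} (h : KKT A ρ φ b τ x u μ) :
    WithLp.toLp 2 (u, -μ) ∈ subdiff (value A ρ φ) (WithLp.toLp 2 (b, τ)) := by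
  obtain ⟨α, hα, H⟩ := mem_subdiff_iff.1 h.2.1
  refine (mem_subdiff_value_iff hρ).2 ⟨α, ?_, fun z t hz w r hw => ?_⟩
  · rw [value_eq_of_mem_primalSol (h.optCond.mem_primalSol hρ), objective_of_mem_lev h.1, hα]
  · have h1 := H w r hw
    have h2 := h.2.2.2 z t hz
    rw [← inner_lin, map_sub] at h2
    simp only [inner_sub_right, inner_add_right] at *
    linarith

lemma exists_kkt_of_mem_subdiff_value (hρ : ClosedProperConvex ρ)
    {x : EuclideanSpace ℝ (Fin n)} (hx : x ∈ primalSol A ρ φ b τ)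
    {p : WithLp 2 (EuclideanSpace ℝ (Fin m) × ℝ)}
    (hp : p ∈ subdiff (value A ρ φ) (WithLp.toLp 2 (b, τ))) :
    ∃ u μ, KKT A ρ φ b τ x u μ ∧ p = WithLp.toLp 2 (u, -μ) := by
  obtain ⟨hxτ, α, hα, -⟩ := (mem_primalSol_iff hρ).1 hx
  have hp' : WithLp.toLp 2 (p.fst, p.snd) ∈ subdiff (value A ρ φ) (WithLp.toLp 2 (b, τ)) := hp
  obtain ⟨β, hβ, H⟩ := (mem_subdiff_value_iff hρ).1 hp'
  rw [value_eq_of_mem_primalSol hx, objective_of_mem_lev hxτ, hα] at hβ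
  obtain rfl : α = β := by exact_mod_cast hβ
  refine ⟨p.fst, -p.snd, ⟨hxτ, mem_subdiff_iff.2 ⟨α, hα, fun w r hw => ?_⟩, ?_, fun z t hz => ?_⟩,
    by rw [neg_neg]; rfl⟩
  · have h1 := H x τ hxτ w r hw
    simp only [inner_sub_right, inner_add_right] at *
    linarith
  · have hxτ' : φ x ≤ ((τ + 1 : ℝ) : EReal) :=
      le_trans hxτ (EReal.coe_le_coe_iff.2 (by linarith))
    have h1 := H x (τ + 1) hxτ' _ α hα.le
    rw [sub_add_cancel, sub_self, inner_zero_right] at h1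
    linarith
  · have h1 := H z t hz _ α hα.le
    rw [← inner_lin, map_sub]
    simp only [inner_sub_right, inner_add_right] at *
    linarith

end Subdifferential

end ValueFn

/-! ### The value function -/

theorem mainTheorem1 (m n : ℕ) (A : Matrix (Fin m) (Fin n) ℝ)
    (ρ : EuclideanSpace ℝ (Fin m) → EReal) (φ : EuclideanSpace ℝ (Fin n) → EReal)
    (hρ : ValueFn.ClosedProperConvex ρ) (hφ : ValueFn.ClosedProperConvex φ)
    (b : EuclideanSpace ℝ (Fin m)) (τ : ℝ) :
    (∀ x u, ValueFn.OptCond A ρ φ b τ x u →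
      x ∈ ValueFn.primalSol A ρ φ b τ ∧ u ∈ ValueFn.reducedDualSol A ρ φ b τ) ∧
    (ValueFn.PrimalRegular A ρ φ b τ → ∀ x ∈ ValueFn.primalSol A ρ φ b τ,
      ∃ u, ValueFn.OptCond A ρ φ b τ x u) ∧
    (ValueFn.DualRegular A ρ φ τ → (ValueFn.lev φ τ).Nonempty →
      ∀ u ∈ ValueFn.reducedDualSol A ρ φ b τ, ∃ x, ValueFn.OptCond A ρ φ b τ x u) ∧
    (ValueFn.PrimalRegular A ρ φ b τ → ValueFn.DualRegular A ρ φ τ →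
      ∀ x u, ValueFn.OptCond A ρ φ b τ x u ↔
        x ∈ ValueFn.primalSol A ρ φ b τ ∧ u ∈ ValueFn.reducedDualSol A ρ φ b τ) ∧
    ((∃ x, φ x < (τ : EReal)) →
      ((ValueFn.PrimalCoercive A ρ φ ∧ ValueFn.PrimalRegular A ρ φ b τ) ∨
        (ValueFn.DualCoercive A ρ φ b τ ∧ ValueFn.DualRegular A ρ φ τ)) →
      (ValueFn.subdiff (ValueFn.value A ρ φ) (WithLp.toLp 2 (b, τ))).Nonempty ∧
      (∀ x u, ValueFn.OptCond A ρ φ b τ x u →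
        (ValueFn.multipliers φ τ (ValueFn.lin A.transpose u)).Nonempty) ∧
      ValueFn.subdiff (ValueFn.value A ρ φ) (WithLp.toLp 2 (b, τ)) =
        {p | ∃ x u μ, ValueFn.OptCond A ρ φ b τ x u ∧
          μ ∈ ValueFn.multipliers φ τ (ValueFn.lin A.transpose u) ∧
          p = WithLp.toLp 2 (u, -μ)} ∧
      ValueFn.subdiff (ValueFn.value A ρ φ) (WithLp.toLp 2 (b, τ)) =
        {p | ∃ u μ, (∃ x ∈ ValueFn.lev φ τ,
            0 ∈ {-ValueFn.lin A.transpose u} + ValueFn.extSubdiff μ φ x ∧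
            u ∈ ValueFn.subdiff ρ (b - ValueFn.lin A x) ∧
            0 ≤ μ ∧ (μ : EReal) * (φ x - (τ : EReal)) = 0) ∧
          p = WithLp.toLp 2 (u, -μ)}) := by
  have hri : ValueFn.PrimalRegular A ρ φ b τ →
      b ∈ ValueFn.dom ρ + ValueFn.lin A '' ValueFn.lev φ τ := by
    rintro ⟨w, hw, _, ⟨x, hx, rfl⟩, rfl⟩
    exact ⟨w, intrinsicInterior_subset hw, _, ⟨x, intrinsicInterior_subset hx, rfl⟩, rfl⟩
  refine ⟨fun x u h => ⟨h.mem_primalSol hρ, h.mem_reducedDualSol hρ⟩,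
    fun hPR x hx => ValueFn.exists_optCond_of_primalSol hρ hφ hPR.relCore hx,
    fun hDR hne u hu => ValueFn.exists_optCond_of_reducedDualSol hρ hφ hDR hne hu,
    fun hPR _ x u => ⟨fun h => ⟨h.mem_primalSol hρ, h.mem_reducedDualSol hρ⟩, fun ⟨hx, hu⟩ => ?_⟩,
    fun hτ hreg => ?_⟩
  · obtain ⟨u', hu'⟩ := ValueFn.exists_optCond_of_primalSol hρ hφ hPR.relCore hx
    exact ValueFn.optCond_of_sol hρ hu' hu
  obtain ⟨⟨x₀, hx₀⟩, hcore⟩ : (ValueFn.primalSol A ρ φ b τ).Nonempty ∧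
      ValueFn.RelCore (ValueFn.dom ρ + ValueFn.lin A '' ValueFn.lev φ τ) b := by
    rcases hreg with ⟨hPC, hPR⟩ | ⟨hDC, hDR⟩
    · exact ⟨hPC.exists_primalSol hρ hφ (hri hPR), hPR.relCore⟩
    · exact ⟨hDR.exists_primalSol hρ hφ (interior_subset hDC),
        ValueFn.relCore_of_mem_interior hDC⟩
  have hiff : ∀ p, p ∈ ValueFn.subdiff (ValueFn.value A ρ φ) (WithLp.toLp 2 (b, τ)) ↔
      ∃ x u μ, ValueFn.KKT A ρ φ b τ x u μ ∧ p = WithLp.toLp 2 (u, -μ) := by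
    refine fun p => ⟨fun hp => ⟨x₀, ValueFn.exists_kkt_of_mem_subdiff_value hρ hx₀ hp⟩, ?_⟩
    rintro ⟨x, u, μ, h, rfl⟩
    exact h.mem_subdiff_value hρ
  refine ⟨?_, fun x u h => ?_, ?_, ?_⟩
  · obtain ⟨u, hu⟩ := ValueFn.exists_optCond_of_primalSol hρ hφ hcore hx₀
    obtain ⟨μ, hμ⟩ := hu.exists_kkt hφ hτ
    exact ⟨_, hμ.mem_subdiff_value hρ⟩
  · obtain ⟨μ, hμ⟩ := h.exists_kkt hφ hτ
    exact ⟨μ, hμ.mem_multipliers hφ⟩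
  · ext p
    simp only [hiff, ValueFn.kkt_iff_optCond hφ hτ, and_assoc, Set.mem_ofPred_eq]
  · ext p
    rw [hiff]
    constructor
    · rintro ⟨x, u, μ, h, rfl⟩
      obtain ⟨hx, h⟩ := (ValueFn.kkt_iff_extSubdiff hφ).1 h
      exact ⟨u, μ, ⟨x, hx, h⟩, rfl⟩
    · rintro ⟨u, μ, ⟨x, hx, h⟩, rfl⟩
      exact ⟨x, u, μ, (ValueFn.kkt_iff_extSubdiff hφ).2 ⟨hx, h⟩, rfl⟩
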